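/- Consider a stochastic $k$-armed bandit problem with $k\ge 1$. An environment $\mathcal D=(\mathcal D_1,\dots,\mathcal D_k)$ consists of reward distributions on $\mathbb R$ with means $\mu_1,\dots,\mu_k$ that satisfy $|\mu_i-\mu_j|\le 1$ for all $i,j$ and are standardized sub-Gaussian, i.e. $\mathbb E_{X\sim\mathcal D_i}\,e^{\lambda(X-\mu_i)}\le e^{\lambda^2/2}$ for all $\lambda\in\mathbb R$. A policy $\pi$ (which may be randomized and may depend on the horizon $T$) chooses in each round $t=1,\dots,T$ an action $\pi_t\in[k]=\{1,\dots,k\}$ on the basis of the past actions and observed rewards, and then observes a reward drawn from $\mathcal D_{\pi_t}$, independently of the past given $\pi_t$. Let $\mathbb P^\pi_{\mathcal D}$, $\mathbb E^\pi_{\mathcal D}$ be the resulting probability and expectation with horizon $T$, let $\mu^*=\max_i\mu_i$, and let $$R^\pi(T)=\sup_{\mathcal D}\Big\{T\mu^*-\mathbb E^\pi_{\mathcal D}\Big[\sum_{t=1}^T\mu_{\pi_t}\Big]\Big\}.$$ For integers $T_1,T_2$, a cover is finished in the period $[T_1:T_2]$, with starting round $T_1$ and ending round $T_2$, if every action in $[k]$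 is chosen in at least one round $t$ with $T_1\le t\le T_2$. Asynchronous covers are covers such that the ending round of each is at most the starting round of the next. Theorem. Let $N\ge 0$ be an integer and let $\pi$ be a policy such that, for some $\epsilon>0$, $R^\pi(T)=\tilde O\big(T^{\frac{1}{2-2^{-N}}-\epsilon}\big)$, that is, $R^\pi(T)=O\big(T^{\frac{1}{2-2^{-N}}-\epsilon}(\log T)^p\big)$ as $T\to\infty$ for some integer $p\ge 0$. Then there exist an environment $\mathcal D$ with a unique optimal action $i^*$ (so $\mu_{i^*}>\mu_j$ for all $j\ne i^*$) and a horizon $T\ge 1$ such that, with $\mathbb P^\pi_{\mathcal D}$-probability at least $\max\{N/(N+1),1/2\}$, the sequence $\pi_1,\dots,\pi_T$ finishes $N+1$ asynchronous covers and then switches to the optimal action: there is a round $\tau$ such that $N+1$ asynchronous covers are finished in the period $[1:\tau]$, and a round $t$ with $\tau\le t\le T$ and $\pi_t=i^*$. -/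

import Mathlib

open MeasureTheory ProbabilityTheory Filter
open scoped BigOperators

noncomputable section

namespace Bandit

/-- An environment of a `k`-armed bandit: reward distributions `D_i` that are standardized
sub-Gaussian (`E exp (l (X - E X)) ≤ exp (l ^ 2 / 2)` for all real `l`), and whose means differ
pairwise by at most one. -/
structure Environment (k : ℕ) where
  dist : Fin k → Measure ℝ
  isProb : ∀ i, IsProbabilityMeasure (dist i)
  subGaussian : ∀ i, HasSubgaussianMGF (fun x : ℝ => x - ∫ y, y ∂(dist i)) 1 (dist i)
  gap_le_one : ∀ i j, |(∫ x, x ∂(dist i)) - ∫ x, x ∂(dist j)| ≤ 1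

namespace Environment

variable {k : ℕ}

/-- The expected reward of an action. -/
def mean (D : Environment k) (i : Fin k) : ℝ := ∫ x, x ∂(D.dist i)

/-- The largest expected reward. -/
def bestMean (D : Environment k) : ℝ := ⨆ i, D.mean i

/-- `i` is the (unique) optimal action. -/
def IsOptimal (D : Environment k) (i : Fin k) : Prop := ∀ j, j ≠ i → D.mean j < D.mean i

/-- The conditional law of the observed reward given the chosen action. -/
def rewardKernel (D : Environment k) : Kernel (Fin k) ℝ := Kernel.ofFunOfCountable D.dist

instance (D : Environment k) : IsMarkovKernel D.rewardKernel := ⟨D.isProb⟩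

end Environment

/-- The actions and observed rewards of the first `t` rounds. -/
abbrev History (k t : ℕ) : Type := Fin t → Fin k × ℝ

/-- A (randomized, non-anticipating) learning policy for `k` actions. It may depend on the
horizon: `act T t` is the law of the action of round `t + 1` given the history of the first `t`
rounds, when the horizon is `T` (only the rounds `t + 1 ≤ T` are used). -/
structure Policy (k : ℕ) where
  act : (T t : ℕ) → Kernel (History k t) (Fin k)
  isMarkov : ∀ T t, IsMarkovKernel (act T t)

variable {k : ℕ}

instance (π : Policy k) (T t : ℕ) : IsMarkovKernel (π.act T t) := π.isMarkov T t

/-- Given the history, the joint law of the next action and of the reward that it yields. -/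
def stepKernel (π : Policy k) (D : Environment k) (T t : ℕ) : Kernel (History k t) (Fin k × ℝ) :=
  π.act T t ⊗ₖ Kernel.prodMkLeft (History k t) D.rewardKernel

instance (π : Policy k) (D : Environment k) (T t : ℕ) : IsMarkovKernel (stepKernel π D T t) := by
  unfold stepKernel; infer_instance

/-- The law of the history of the first `t` rounds, under policy `π` run with horizon `T` in the
environment `D`. -/
def historyLaw (π : Policy k) (D : Environment k) (T : ℕ) : (t : ℕ) → Measure (History k t)
  | 0 => Measure.dirac Fin.elim0
  | t + 1 => (historyLaw π D T t ⊗ₘ stepKernel π D T t).map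
      (fun p => (Fin.snoc p.1 p.2 : History k (t + 1)))

theorem measurable_snoc (t : ℕ) :
    Measurable (fun p : History k t × (Fin k × ℝ) => (Fin.snoc p.1 p.2 : History k (t + 1))) := by
  refine measurable_pi_lambda _ fun i => ?_
  refine Fin.lastCases ?_ (fun j => ?_) i
  · simpa using measurable_snd
  · simpa [Function.comp_def] using (measurable_pi_apply j).comp measurable_fst

instance isProbabilityMeasure_historyLaw (π : Policy k) (D : Environment k) (T t : ℕ) :
    IsProbabilityMeasure (historyLaw π D T t) := by
  induction t with
  | zero => unfold historyLaw; infer_instance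
  | succ t ih =>
    unfold historyLaw
    exact Measure.isProbabilityMeasure_map (measurable_snoc t).aemeasurable

/-- The law of all actions and rewards of the `T` rounds. -/
def law (π : Policy k) (D : Environment k) (T : ℕ) : Measure (History k T) := historyLaw π D T T

instance (π : Policy k) (D : Environment k) (T : ℕ) : IsProbabilityMeasure (law π D T) := by
  unfold law; infer_instance

/-- The sequence of chosen actions (the bandit random walk) in a history. -/
def actions {T : ℕ} (h : History k T) : Fin T → Fin k := fun t => (h t).1

/-- Expected loss of `π` in the environment `D`, compared with always playing the best action. -/
def regretIn (π : Policy k) (D : Environment k) (T : ℕ) : ℝ :=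
  T * D.bestMean - ∫ h, ∑ t, D.mean (actions h t) ∂(law π D T)

/-- The worst-case regret. -/
def regret (π : Policy k) (T : ℕ) : ℝ := ⨆ D : Environment k, regretIn π D T

/-- The supremum that defines the worst-case regret is over a bounded set. -/
theorem bddAbove_regretIn (π : Policy k) (T : ℕ) :
    BddAbove (Set.range fun D : Environment k => regretIn π D T) := by
  refine ⟨T, ?_⟩
  rintro _ ⟨D, rfl⟩
  have hb : ∀ i, D.bestMean - 1 ≤ D.mean i := by
    intro i
    have : Nonempty (Fin k) := ⟨i⟩
    have : D.bestMean ≤ D.mean i + 1 := by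
      refine ciSup_le fun j => ?_
      have := (abs_le.1 (D.gap_le_one j i)).2
      unfold Environment.mean
      linarith
    linarith
  have hmeas : ∀ t : Fin T, Measurable fun h : History k T => D.mean (actions h t) := fun t =>
    (measurable_of_finite D.mean).comp (measurable_fst.comp (measurable_pi_apply t))
  have hint : Integrable (fun h : History k T => ∑ t, D.mean (actions h t)) (law π D T) := by
    refine integrable_finsetSum _ fun t _ => ?_
    refine Integrable.of_bound (hmeas t).aestronglyMeasurable (∑ i, ‖D.mean i‖) ?_
    exact Eventually.of_forall fun h =>
      Finset.single_le_sum (f := fun i => ‖D.mean i‖) (fun i _ => norm_nonneg _)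
        (Finset.mem_univ _)
  have h1 : ∫ _ : History k T, (T : ℝ) * (D.bestMean - 1) ∂(law π D T)
      ≤ ∫ h, ∑ t, D.mean (actions h t) ∂(law π D T) := by
    refine integral_mono (integrable_const _) hint fun h => ?_
    have := Finset.card_nsmul_le_sum Finset.univ (fun t => D.mean (actions h t))
      (D.bestMean - 1) (fun t _ => hb _)
    simpa using this
  simp only [integral_const, probReal_univ, one_smul] at h1
  simp only [regretIn]
  linarith

/-- The regret of `π` is `Õ(T ^ e)`: big-O as `T → ∞`, up to a power of `log T`. -/
def AchievesRegretExponent (π : Policy k) (e : ℝ) : Prop :=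
  ∃ p : ℕ, (fun T : ℕ => regret π T) =O[atTop] fun T : ℕ => (T : ℝ) ^ e * Real.log T ^ p

/-- All actions are chosen in the period `[T₁ : T₂]`. The rounds are numbered `1, …, T`, and
`a t` is the action of round `t + 1`. -/
def FinishesCover {T : ℕ} (a : Fin T → Fin k) (T₁ T₂ : ℕ) : Prop :=
  ∀ i : Fin k, ∃ t : Fin T, T₁ ≤ (t : ℕ) + 1 ∧ (t : ℕ) + 1 ≤ T₂ ∧ a t = i

/-- `n` asynchronous covers are finished in the period `[T₁ : T₂]`: the `j`-th one has starting
round `s j` and ending round `e j`. -/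
def FinishesAsyncCovers {T : ℕ} (a : Fin T → Fin k) (n T₁ T₂ : ℕ) : Prop :=
  ∃ s e : Fin n → ℕ,
    (∀ j, T₁ ≤ s j ∧ e j ≤ T₂ ∧ FinishesCover a (s j) (e j)) ∧
    ∀ j j' : Fin n, (j : ℕ) + 1 = j' → e j ≤ s j'

/-- `n` asynchronous covers are finished in a period `[1 : τ]`, and action `i` is chosen in some
round from `τ` on (and up to the last round `T`). -/
def CoversThenSwitchesTo {T : ℕ} (a : Fin T → Fin k) (n : ℕ) (i : Fin k) : Prop :=
  ∃ τ : ℕ, FinishesAsyncCovers a n 1 τ ∧ ∃ t : Fin T, τ ≤ (t : ℕ) + 1 ∧ a t = i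

end Bandit

end

noncomputable section

namespace Bandit

open scoped ENNReal Topology

/-! ### Square domination of measures -/

/-! Write `α = 1 / (2 - 2⁻ᴺ)`, and let `t_j ≈ M ^ x_j` and `δ_j ≈ t_j ^ (-1/2)` be the checkpoints
and hidden gaps, with horizon `2 * M`. In the base environment one action `i₀` has mean `δ_N` and
all others have mean `0`.

Suppose that, in the base environment, action `i` is skipped between `t_j` and `t_{j+1}` with
probability `p`. Raise the mean of `i` alone to `δ_N + δ_j`. While `i` is skipped nothing reveals
the change, so the two environments can be told apart only through the first `t_j` rounds, and `t_j
* δ_j ^ 2` is bounded. A `χ²` bound gives `p ^ 2 ≤ 2 * p'` for the probability `p'` of the same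
event after the change (`sq_law_avoiding_le`). There `i` is best by `δ_j`, so skipping it costs
about `δ_j * t_{j+1} ≈ M ^ α` (`mul_law_avoiding_le_regret`). The regret is of smaller order, so
`p'`, and with it `p`, tends to `0`.

The exponents solve `x_{j+1} - x_j / 2 = α` with `x_0 = 0`, and this value of `α` gives `x_{N+1} =
1`: there is room for `N + 1` periods. The last `M` rounds force the switch, since skipping `i₀`
there costs `δ_N * M ≈ M ^ α` in the base environment itself. A union bound makes the probability of
success tend to `1`. -/

/-- The `χ²`-type bound `(∫ f dμ) ^ 2 ≤ c * ∫ f ^ 2 dν` for all nonnegative measurable `f`. -/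
def SqDominated {α : Type*} [MeasurableSpace α] (c : ℝ≥0∞) (μ ν : Measure α) : Prop :=
  ∀ f : α → ℝ≥0∞, Measurable f → (∫⁻ x, f x ∂μ) ^ 2 ≤ c * ∫⁻ x, f x ^ 2 ∂ν

/-- Cauchy–Schwarz against the constant `1`. It handles the randomness of the policy and the rewards
of unchanged actions at no cost. -/
theorem sqDominated_self {α : Type*} [MeasurableSpace α] (μ : Measure α) [IsProbabilityMeasure μ] :
    SqDominated 1 μ μ := by
  intro f hf
  have h := ENNReal.lintegral_mul_le_Lp_mul_Lq μ Real.HolderConjugate.two_two hf.aemeasurable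
    (aemeasurable_const (b := (1 : ℝ≥0∞)))
  simp only [Pi.mul_apply, mul_one, ENNReal.one_rpow, lintegral_const, measure_univ] at h
  have h2 := ENNReal.rpow_le_rpow h (by norm_num : (0 : ℝ) ≤ 2)
  rw [← ENNReal.rpow_mul] at h2
  simpa using h2

/-- The law on `{-1, 1}` with mean `m`. -/
def twoPoint (m : ℝ) : Measure ℝ :=
  ENNReal.ofReal ((1 + m) / 2) • Measure.dirac 1 + ENNReal.ofReal ((1 - m) / 2) • Measure.dirac (-1)

theorem lintegral_twoPoint (m : ℝ) {f : ℝ → ℝ≥0∞} (hf : Measurable f) :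
    ∫⁻ x, f x ∂(twoPoint m) =
      ENNReal.ofReal ((1 + m) / 2) * f 1 + ENNReal.ofReal ((1 - m) / 2) * f (-1) := by
  simp [twoPoint, lintegral_add_measure, lintegral_smul_measure, lintegral_dirac' _ hf]

theorem isProbabilityMeasure_twoPoint {m : ℝ} (hm : m ∈ Set.Icc (-1) 1) :
    IsProbabilityMeasure (twoPoint m) := by
  constructor
  have := lintegral_twoPoint m (f := fun _ => 1) measurable_const
  simp only [lintegral_const, one_mul, mul_one] at this
  rw [this, ← ENNReal.ofReal_add (by linarith [hm.1]) (by linarith [hm.2])]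
  ring_nf
  simp

theorem integral_twoPoint {m : ℝ} (hm : m ∈ Set.Icc (-1) 1) : ∫ x, x ∂(twoPoint m) = m := by
  have hi : ∀ (c : ℝ≥0∞) (a : ℝ), c ≠ ⊤ → Integrable (fun x : ℝ => x) (c • Measure.dirac a) :=
    fun c a hc => (integrable_dirac (by simp)).smul_measure hc
  rw [twoPoint, integral_add_measure (hi _ _ (by simp)) (hi _ _ (by simp)), integral_smul_measure,
    integral_smul_measure, integral_dirac, integral_dirac,
    ENNReal.toReal_ofReal (by linarith [hm.1]), ENNReal.toReal_ofReal (by linarith [hm.2])]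
  simp only [smul_eq_mul]
  ring

theorem ae_mem_Icc_twoPoint (m : ℝ) : ∀ᵐ x ∂(twoPoint m), x ∈ Set.Icc (-1 : ℝ) 1 := by
  rw [ae_iff, twoPoint]
  simp

/-- Hoeffding's lemma: an interval of length `2` gives variance proxy `1`. -/
theorem hasSubgaussianMGF_twoPoint {m : ℝ} (hm : m ∈ Set.Icc (-1) 1) :
    HasSubgaussianMGF (fun x : ℝ => x - ∫ y, y ∂(twoPoint m)) 1 (twoPoint m) := by
  have := isProbabilityMeasure_twoPoint hm
  have h := hasSubgaussianMGF_of_mem_Icc (μ := twoPoint m) (X := fun x : ℝ => x) aemeasurable_id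
    (ae_mem_Icc_twoPoint m)
  have hc : ((‖(1 : ℝ) - (-1)‖₊ / 2) ^ 2 : NNReal) = 1 := by
    ext; simp; norm_num
  rwa [hc] at h

/-- The best constant is one plus the `χ²` divergence, `1 + (m - m') ^ 2 / (1 - m' ^ 2)`, and `m' ≤
1 / 2` bounds the last factor by `4 / 3`. -/
theorem sqDominated_twoPoint {m m' : ℝ} (hm : m ∈ Set.Icc (0 : ℝ) (1 / 2))
    (hm' : m' ∈ Set.Icc (0 : ℝ) (1 / 2)) :
    SqDominated (ENNReal.ofReal (1 + 2 * (m - m') ^ 2)) (twoPoint m) (twoPoint m') := by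
  obtain ⟨h0, h1⟩ := hm
  obtain ⟨h0', h1'⟩ := hm'
  intro f hf
  rw [lintegral_twoPoint m hf, lintegral_twoPoint m' (hf.pow_const 2)]
  have hc : 0 < 1 + 2 * (m - m') ^ 2 := by positivity
  generalize f 1 = x
  generalize f (-1) = y
  by_cases hx : x = ⊤
  · have : ENNReal.ofReal ((1 + m') / 2) ≠ 0 := by simp; linarith
    have hcc : ENNReal.ofReal (1 + 2 * (m - m') ^ 2) ≠ 0 := by simpa using hc
    simp [hx, ENNReal.mul_top this, ENNReal.mul_top hcc]
  by_cases hy : y = ⊤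
  · have : ENNReal.ofReal ((1 - m') / 2) ≠ 0 := by simp; linarith
    have hcc : ENNReal.ofReal (1 + 2 * (m - m') ^ 2) ≠ 0 := by simpa using hc
    simp [hy, ENNReal.mul_top this, ENNReal.mul_top hcc]
  lift x to NNReal using hx
  lift y to NNReal using hy
  rw [← ENNReal.ofReal_coe_nnreal, ← ENNReal.ofReal_coe_nnreal]
  have hx0 : (0 : ℝ) ≤ x := x.2
  have hy0 : (0 : ℝ) ≤ y := y.2
  generalize (x : ℝ) = x at *
  generalize (y : ℝ) = y at *
  have hp : 0 ≤ (1 + m) / 2 := by linarith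
  have hp' : 0 ≤ (1 - m) / 2 := by linarith
  have hq : 0 < (1 + m') / 2 := by linarith
  have hq' : 0 < (1 - m') / 2 := by linarith
  rw [← ENNReal.ofReal_mul hp, ← ENNReal.ofReal_mul hp', ← ENNReal.ofReal_add (by positivity)
    (by positivity), ← ENNReal.ofReal_pow (by positivity), ← ENNReal.ofReal_pow hx0,
    ← ENNReal.ofReal_pow hy0, ← ENNReal.ofReal_mul hq.le, ← ENNReal.ofReal_mul hq'.le,
    ← ENNReal.ofReal_add (by positivity) (by positivity), ← ENNReal.ofReal_mul hc.le]
  apply ENNReal.ofReal_le_ofReal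
  -- With the weights `p, p'` of `twoPoint m` and `q, q'` of `twoPoint m'`, this is `p² / q + p'² /
  -- q' ≤ c` cleared of denominators; weighted Cauchy–Schwarz then finishes.
  have hd : ((1 + m) / 2) ^ 2 * ((1 - m') / 2) + ((1 - m) / 2) ^ 2 * ((1 + m') / 2)
      ≤ (1 + 2 * (m - m') ^ 2) * ((1 + m') / 2 * ((1 - m') / 2)) := by
    have h3 : m' ^ 2 ≤ 1 / 4 := by nlinarith
    nlinarith [mul_nonneg (sq_nonneg (m - m')) (sub_nonneg.2 h3), sq_nonneg (m - m')]
  generalize (1 + m) / 2 = p at *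
  generalize (1 - m) / 2 = p' at *
  generalize (1 + m') / 2 = q at *
  generalize (1 - m') / 2 = q' at *
  generalize 1 + 2 * (m - m') ^ 2 = c at *
  have h4 := mul_le_mul_of_nonneg_right hd (by positivity : 0 ≤ q * x ^ 2 + q' * y ^ 2)
  have h5 : (q * q') * (p * x + p' * y) ^ 2 ≤ (q * q') * (c * (q * x ^ 2 + q' * y ^ 2)) := by
    nlinarith [sq_nonneg (p * q' * y - p' * q * x)]
  exact le_of_mul_le_mul_left h5 (by positivity)

/-! ### Laws of histories -/

variable {k : ℕ}

theorem lintegral_stepKernel (π : Policy k) (D : Environment k) (T t : ℕ) (h : History k t)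
    {f : Fin k × ℝ → ℝ≥0∞} (hf : Measurable f) :
    ∫⁻ p, f p ∂(stepKernel π D T t h) = ∫⁻ a, ∫⁻ x, f (a, x) ∂(D.dist a) ∂(π.act T t h) := by
  rw [stepKernel, Kernel.lintegral_compProd _ _ _ hf]
  rfl

theorem lintegral_historyLaw_succ (π : Policy k) (D : Environment k) (T t : ℕ)
    {f : History k (t + 1) → ℝ≥0∞} (hf : Measurable f) :
    ∫⁻ h, f h ∂(historyLaw π D T (t + 1)) =
      ∫⁻ h, ∫⁻ p, f (Fin.snoc h p : History k (t + 1)) ∂(stepKernel π D T t h)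
        ∂(historyLaw π D T t) := by
  rw [historyLaw, lintegral_map hf (measurable_snoc t)]
  exact Measure.lintegral_compProd (hf.comp (measurable_snoc t))

/-- The histories in which action `i` is not chosen in any of the rounds `a + 1, …, b`. -/
def avoiding (i : Fin k) (a b t : ℕ) : Set (History k t) :=
  {h | ∀ s : Fin t, a ≤ s → (s : ℕ) < b → (h s).1 ≠ i}

theorem measurableSet_avoiding (i : Fin k) (a b t : ℕ) : MeasurableSet (avoiding i a b t) := by
  have : avoiding i a b t = ⋂ s : Fin t, {h | a ≤ s → (s : ℕ) < b → (h s).1 ≠ i} := by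
    ext; simp [avoiding]
  rw [this]
  refine MeasurableSet.iInter fun s => ?_
  have hm : Measurable fun h : History k t => (h s).1 := measurable_fst.comp (measurable_pi_apply s)
  exact hm (t := {j | a ≤ s → (s : ℕ) < b → j ≠ i}) (Set.toFinite _).measurableSet

theorem snoc_mem_avoiding {i : Fin k} {a b t : ℕ} {h : History k t} {p : Fin k × ℝ} :
    (Fin.snoc h p : History k (t + 1)) ∈ avoiding i a b (t + 1) ↔
      h ∈ avoiding i a b t ∧ (a ≤ t → t < b → p.1 ≠ i) := by
  simp only [avoiding, Set.mem_ofPred_eq]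
  constructor
  · intro H
    refine ⟨fun s hs hb => ?_, fun hs hb => ?_⟩
    · simpa using H s.castSucc hs hb
    · simpa using H (Fin.last t) hs hb
  · rintro ⟨H1, H2⟩ s
    refine Fin.lastCases ?_ (fun s => ?_) s
    · simpa using H2
    · simpa using H1 s

theorem historyLaw_avoiding_eq (π : Policy k) (D : Environment k) (T : ℕ) (i : Fin k) (a b : ℕ)
    {t : ℕ} (hbt : b ≤ t) :
    historyLaw π D T t (avoiding i a b t) = historyLaw π D T b (avoiding i a b b) := by
  induction t, hbt using Nat.le_induction with
  | base => rfl
  | succ t hbt ih =>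
    rw [← ih, ← lintegral_indicator_one (measurableSet_avoiding ..),
      ← lintegral_indicator_one (measurableSet_avoiding ..), lintegral_historyLaw_succ _ _ _ _
        (measurable_one.indicator (measurableSet_avoiding ..))]
    refine lintegral_congr fun h => ?_
    have : ∀ p : Fin k × ℝ, (avoiding i a b (t + 1)).indicator (1 : History k (t + 1) → ℝ≥0∞)
        (Fin.snoc h p : History k (t + 1)) = (avoiding i a b t).indicator 1 h := by
      intro p
      have : (Fin.snoc h p : History k (t + 1)) ∈ avoiding i a b (t + 1) ↔
          h ∈ avoiding i a b t := by
        rw [snoc_mem_avoiding]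
        exact and_iff_left fun _ hb => absurd hb (by omega)
      classical
      simp only [Set.indicator_apply, this, Pi.one_apply]
    simp [this]

/-- If `D` and `D'` differ only in action `i`, then on functions that vanish unless `i` is avoided
after round `a`, the change of environment costs only the first `a` rounds. -/
theorem sq_lintegral_historyLaw_le (π : Policy k) {D D' : Environment k} (T : ℕ) {i : Fin k} {a : ℕ}
    {c : ℝ≥0∞} (hc : 1 ≤ c) (hne : ∀ j, j ≠ i → D.dist j = D'.dist j)
    (hi : SqDominated c (D.dist i) (D'.dist i)) (t : ℕ) (f : History k t → ℝ≥0∞) (hf : Measurable f)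
    (hf0 : ∀ h, h ∉ avoiding i a t t → f h = 0) :
    (∫⁻ h, f h ∂(historyLaw π D T t)) ^ 2 ≤
      c ^ (min a t) * ∫⁻ h, f h ^ 2 ∂(historyLaw π D' T t) := by
  induction t with
  | zero => simp [historyLaw, lintegral_dirac' _ hf, lintegral_dirac' _ (hf.pow_const 2)]
  | succ t ih =>
    have hpi : ∀ j, IsProbabilityMeasure (D.dist j) := D.isProb
    have hfs : ∀ h : History k t,
        Measurable fun p : Fin k × ℝ => f (Fin.snoc h p : History k (t + 1)) :=
      fun h => (hf.comp (measurable_snoc t)).comp measurable_prodMk_left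
    -- Integrating out the last round leaves a function that still vanishes unless `i` is avoided,
    -- so the induction hypothesis applies to it.
    set g : History k t → ℝ≥0∞ := fun h =>
      ∫⁻ p, f (Fin.snoc h p : History k (t + 1)) ∂(stepKernel π D T t h) with hg
    have hgm : Measurable g :=
      Measurable.lintegral_kernel_prod_right' (hf.comp (measurable_snoc t))
    have hg0 : ∀ h, h ∉ avoiding i a t t → g h = 0 := by
      intro h hh
      have : ∀ p : Fin k × ℝ, f (Fin.snoc h p : History k (t + 1)) = 0 := by
        intro p
        refine hf0 _ fun hm => hh ?_
        intro s hs hst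
        have := hm s.castSucc hs (by simp)
        simpa using this
      simp [hg, this]
    -- The price of one round: `c` among the first `a` rounds, whichever action is played, and
    -- nothing later.
    set d : ℝ≥0∞ := if t < a then c else 1 with hd
    have hstep : ∀ h, g h ^ 2 ≤
        d * ∫⁻ p, f (Fin.snoc h p : History k (t + 1)) ^ 2 ∂(stepKernel π D' T t h) := by
      intro h
      have hdtop : ∀ j, (∫⁻ x, f (Fin.snoc h (j, x) : History k (t + 1)) ∂(D.dist j)) ^ 2 ≤
          d * ∫⁻ x, f (Fin.snoc h (j, x) : History k (t + 1)) ^ 2 ∂(D'.dist j) := by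
        intro j
        have hm : Measurable fun x => f (Fin.snoc h (j, x) : History k (t + 1)) :=
          (hfs h).comp measurable_prodMk_left
        have hd1 : 1 ≤ d := by rw [hd]; split_ifs <;> simp [hc]
        by_cases hj : j = i
        · subst hj
          by_cases hta : t < a
          · simpa [hd, hta] using hi _ hm
          -- After round `a`, playing the changed action leaves the support of `f`.
          · have : ∀ x, f (Fin.snoc h (j, x) : History k (t + 1)) = 0 := by
              intro x
              refine hf0 _ fun hm => ?_
              rw [snoc_mem_avoiding] at hm
              exact hm.2 (by omega) (by omega) rfl
            simp [this]
        · rw [← hne j hj]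
          exact (sqDominated_self (D.dist j) _ hm).trans (by gcongr)
      rw [hg]
      simp only
      rw [lintegral_stepKernel _ _ _ _ _ (hfs h), lintegral_stepKernel _ _ _ _ _ ((hfs h).pow_const 2)]
      have h1 := sqDominated_self (π.act T t h)
        (fun j => ∫⁻ x, f (Fin.snoc h (j, x) : History k (t + 1)) ∂(D.dist j)) (measurable_of_finite _)
      rw [one_mul] at h1
      refine h1.trans ((lintegral_mono hdtop).trans ?_)
      rw [lintegral_const_mul _ (measurable_of_finite _)]
    rw [lintegral_historyLaw_succ _ _ _ _ hf, lintegral_historyLaw_succ _ _ _ _ (hf.pow_const 2)]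
    refine (ih g hgm hg0).trans ?_
    refine (mul_le_mul_right (lintegral_mono hstep) _).trans ?_
    have hm2 : Measurable fun h : History k t =>
        ∫⁻ p, f (Fin.snoc h p : History k (t + 1)) ^ 2 ∂(stepKernel π D' T t h) :=
      Measurable.lintegral_kernel_prod_right' ((hf.comp (measurable_snoc t)).pow_const 2)
    rw [lintegral_const_mul _ hm2, ← mul_assoc]
    gcongr
    rw [hd]
    split_ifs with hta
    · rw [← pow_succ]
      exact le_of_eq (by congr 1; omega)
    · rw [mul_one]
      exact le_of_eq (by congr 1; omega)

/-- An indicator is its own square, so square domination compares probabilities. Rounds after `b` do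
not affect the event and are discarded first. -/
theorem sq_law_avoiding_le (π : Policy k) {D D' : Environment k} {T : ℕ} {i : Fin k} {a b : ℕ}
    {c : ℝ≥0∞} (hc : 1 ≤ c) (hne : ∀ j, j ≠ i → D.dist j = D'.dist j)
    (hi : SqDominated c (D.dist i) (D'.dist i)) (hbT : b ≤ T) :
    law π D T (avoiding i a b T) ^ 2 ≤ c ^ a * law π D' T (avoiding i a b T) := by
  rw [law, law, historyLaw_avoiding_eq _ _ _ _ _ _ hbT, historyLaw_avoiding_eq _ _ _ _ _ _ hbT]
  have hm := measurableSet_avoiding i a b b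
  have h := sq_lintegral_historyLaw_le (a := a) π T hc hne hi b ((avoiding i a b b).indicator 1)
    (measurable_one.indicator hm) (fun h hh => by simp [hh])
  have hsq : ∀ h : History k b, (avoiding i a b b).indicator (1 : History k b → ℝ≥0∞) h ^ 2 =
      (avoiding i a b b).indicator 1 h := by
    intro h
    by_cases hh : h ∈ avoiding i a b b <;> simp [hh]
  simp only [hsq] at h
  rw [lintegral_indicator_one hm, lintegral_indicator_one hm] at h
  exact h.trans (by gcongr; exact min_le_left _ _)

/-! ### Regret -/

theorem Environment.mean_le_bestMean (D : Environment k) (i : Fin k) : D.mean i ≤ D.bestMean :=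
  le_ciSup (Set.finite_range D.mean).bddAbove i

theorem integrable_sum_mean (π : Policy k) (D : Environment k) (T : ℕ) :
    Integrable (fun h : History k T => ∑ t, D.mean (actions h t)) (law π D T) := by
  refine integrable_finsetSum _ fun t _ => ?_
  refine Integrable.of_bound ((measurable_of_finite D.mean).comp
    (measurable_fst.comp (measurable_pi_apply t))).aestronglyMeasurable (∑ i, ‖D.mean i‖) ?_
  exact Eventually.of_forall fun h =>
    Finset.single_le_sum (f := fun i => ‖D.mean i‖) (fun i _ => norm_nonneg _) (Finset.mem_univ _)

/-- Avoiding an action whose gap to all others is at least `δ` is costly. -/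
theorem mul_law_avoiding_le_regret (π : Policy k) (D : Environment k) {T : ℕ} {i : Fin k} {a b : ℕ}
    (hab : a ≤ b) (hbT : b ≤ T) {δ : ℝ} (hδ : ∀ j, j ≠ i → D.mean j + δ ≤ D.mean i) :
    δ * ((b : ℝ) - a) * (law π D T).real (avoiding i a b T) ≤ regret π T := by
  refine le_trans ?_ (le_ciSup (bddAbove_regretIn π T) D)
  have hS := measurableSet_avoiding i a b T
  have h1 : ∫ h, (T * D.bestMean - ∑ t, D.mean (actions h t)) ∂(law π D T) = regretIn π D T := by
    rw [integral_sub (integrable_const _) (integrable_sum_mean π D T)]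
    simp [regretIn]
  rw [← h1]
  have h2 : ∫ h, (avoiding i a b T).indicator (fun _ => δ * ((b : ℝ) - a)) h ∂(law π D T) =
      δ * ((b : ℝ) - a) * (law π D T).real (avoiding i a b T) := by
    rw [integral_indicator_const _ hS, smul_eq_mul, mul_comm]
  rw [← h2]
  refine integral_mono ((integrable_const _).indicator hS)
    ((integrable_const _).sub (integrable_sum_mean π D T)) fun h => ?_
  have h3 : (T : ℝ) * D.bestMean - ∑ t, D.mean (actions h t) =
      ∑ t : Fin T, (D.bestMean - D.mean (actions h t)) := by
    simp [Finset.sum_sub_distrib]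
  simp only [h3]
  have h4 : ∀ t, 0 ≤ D.bestMean - D.mean (actions h t) := fun t =>
    sub_nonneg.2 (D.mean_le_bestMean _)
  by_cases hh : h ∈ avoiding i a b T
  · rw [Set.indicator_of_mem hh]
    have h5 : ((Finset.univ : Finset (Fin T)).filter fun t : Fin T => a ≤ (t : ℕ) ∧ (t : ℕ) < b).card
        = b - a := by
      rw [← Nat.card_Ico, ← Finset.card_map Fin.valEmbedding]
      congr 1
      ext s
      simp only [Finset.mem_map, Finset.mem_filter, Finset.mem_univ, true_and,
        Fin.valEmbedding_apply, Finset.mem_Ico]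
      exact ⟨by rintro ⟨t, ht, rfl⟩; exact ht, fun hs => ⟨⟨s, by omega⟩, hs, rfl⟩⟩
    calc δ * ((b : ℝ) - a)
        = ((Finset.univ : Finset (Fin T)).filter fun t : Fin T => a ≤ (t : ℕ) ∧ (t : ℕ) < b).card • δ := by
          rw [h5, nsmul_eq_mul, Nat.cast_sub hab, mul_comm]
      _ ≤ ∑ t ∈ (Finset.univ : Finset (Fin T)).filter fun t : Fin T => a ≤ (t : ℕ) ∧ (t : ℕ) < b,
            (D.bestMean - D.mean (actions h t)) := by
          refine Finset.card_nsmul_le_sum _ _ _ fun t ht => ?_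
          simp only [Finset.mem_filter, Finset.mem_univ, true_and] at ht
          have h6 : D.mean (actions h t) + δ ≤ D.mean i := hδ _ (hh t ht.1 ht.2)
          linarith [D.mean_le_bestMean i]
      _ ≤ _ := Finset.sum_le_univ_sum_of_nonneg h4
  · rw [Set.indicator_of_notMem hh]
    exact Finset.sum_nonneg fun t _ => h4 t

/-! ### Environments with two-point rewards -/

/-- The environment with two-point rewards and given means. -/
def twoPointEnv (m : Fin k → ℝ) (hm : ∀ i, m i ∈ Set.Icc (0 : ℝ) (1 / 2)) : Environment k where
  dist i := twoPoint (m i)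
  isProb i := isProbabilityMeasure_twoPoint ⟨by linarith [(hm i).1], by linarith [(hm i).2]⟩
  subGaussian i := hasSubgaussianMGF_twoPoint ⟨by linarith [(hm i).1], by linarith [(hm i).2]⟩
  gap_le_one i j := by
    have h := fun i => integral_twoPoint (m := m i)
      ⟨by linarith [(hm i).1], by linarith [(hm i).2]⟩
    rw [h, h, abs_le]
    constructor <;> linarith [(hm i).1, (hm i).2, (hm j).1, (hm j).2]

theorem mean_twoPointEnv (m : Fin k → ℝ) (hm : ∀ i, m i ∈ Set.Icc (0 : ℝ) (1 / 2)) (i : Fin k) :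
    (twoPointEnv m hm).mean i = m i :=
  integral_twoPoint ⟨by linarith [(hm i).1], by linarith [(hm i).2]⟩

/-! ### Checkpoints -/

/-- The `j`-th checkpoint of a horizon of order `M` is `M ^ checkpointExponent N j`. -/
def checkpointExponent (N j : ℕ) : ℝ := (2 - 2 * (2 : ℝ)⁻¹ ^ j) / (2 - ((2 : ℝ) ^ N)⁻¹)

theorem two_sub_inv_pow_pos (N : ℕ) : 0 < 2 - ((2 : ℝ) ^ N)⁻¹ := by
  have : ((2 : ℝ) ^ N)⁻¹ ≤ 1 := inv_le_one_of_one_le₀ (one_le_pow₀ (by norm_num))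
  linarith

theorem checkpointExponent_zero (N : ℕ) : checkpointExponent N 0 = 0 := by
  simp [checkpointExponent]

theorem checkpointExponent_last (N : ℕ) : checkpointExponent N (N + 1) = 1 := by
  have h := (two_sub_inv_pow_pos N).ne'
  rw [checkpointExponent, pow_succ, inv_pow]
  rw [div_eq_one_iff_eq h]
  ring

/-- This recursion makes `δ_j * t_{j+1}` of the same order `M ^ α` for every `j`. -/
theorem checkpointExponent_succ_sub (N j : ℕ) :
    checkpointExponent N (j + 1) - checkpointExponent N j / 2 = 1 / (2 - ((2 : ℝ) ^ N)⁻¹) := by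
  rw [checkpointExponent, checkpointExponent, pow_succ]
  ring

theorem checkpointExponent_strictMono (N : ℕ) : StrictMono (checkpointExponent N) := by
  refine strictMono_nat_of_lt_succ fun j => ?_
  refine div_lt_div_of_pos_right ?_ (two_sub_inv_pow_pos N)
  have : (0 : ℝ) < 2⁻¹ ^ j := by positivity
  rw [pow_succ]
  linarith

theorem checkpointExponent_nonneg (N j : ℕ) : 0 ≤ checkpointExponent N j := by
  rw [← checkpointExponent_zero N]
  exact (checkpointExponent_strictMono N).monotone (Nat.zero_le j)

/-- The checkpoints that separate the periods in which all actions have to be chosen. -/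
def checkpoint (N M j : ℕ) : ℕ := ⌊(M : ℝ) ^ checkpointExponent N j⌋₊

/-- The difference of means that cannot be detected before the `j`-th checkpoint. -/
def hiddenGap (N M j : ℕ) : ℝ := 1 / 4 * (M : ℝ) ^ (-(checkpointExponent N j / 2))

theorem checkpoint_mono (N : ℕ) {M : ℕ} (hM : 1 ≤ M) : Monotone (checkpoint N M) := by
  intro i j hij
  exact Nat.floor_le_floor (Real.rpow_le_rpow_of_exponent_le (by exact_mod_cast hM)
    ((checkpointExponent_strictMono N).monotone hij))

theorem checkpoint_last (N M : ℕ) : checkpoint N M (N + 1) = M := by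
  simp [checkpoint, checkpointExponent_last]

theorem hiddenGap_pos (N : ℕ) {M : ℕ} (hM : 1 ≤ M) (j : ℕ) : 0 < hiddenGap N M j := by
  have : (0 : ℝ) < M := by exact_mod_cast hM
  unfold hiddenGap
  positivity

theorem hiddenGap_antitone (N : ℕ) {M : ℕ} (hM : 1 ≤ M) : Antitone (hiddenGap N M) := by
  intro i j hij
  have h := (checkpointExponent_strictMono N).monotone hij
  exact mul_le_mul_of_nonneg_left (Real.rpow_le_rpow_of_exponent_le (by exact_mod_cast hM)
    (by linarith)) (by norm_num)

theorem hiddenGap_le (N : ℕ) {M : ℕ} (hM : 1 ≤ M) (j : ℕ) : hiddenGap N M j ≤ 1 / 4 := by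
  have h := hiddenGap_antitone N hM (Nat.zero_le j)
  simpa [hiddenGap, checkpointExponent_zero] using h

theorem hiddenGap_sq_mul_checkpoint_le (N : ℕ) {M : ℕ} (hM : 1 ≤ M) (j : ℕ) :
    hiddenGap N M j ^ 2 * checkpoint N M j ≤ 1 / 16 := by
  have hM0 : (0 : ℝ) < M := by exact_mod_cast hM
  have h1 : (checkpoint N M j : ℝ) ≤ (M : ℝ) ^ checkpointExponent N j :=
    Nat.floor_le (by positivity)
  have h2 : ((M : ℝ) ^ (-(checkpointExponent N j / 2))) ^ 2 * (M : ℝ) ^ checkpointExponent N j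
      = 1 := by
    rw [sq, ← Real.rpow_add hM0, ← Real.rpow_add hM0]
    ring_nf
    simp
  calc hiddenGap N M j ^ 2 * checkpoint N M j
      ≤ hiddenGap N M j ^ 2 * (M : ℝ) ^ checkpointExponent N j := by gcongr
    _ = 1 / 16 * (((M : ℝ) ^ (-(checkpointExponent N j / 2))) ^ 2 *
          (M : ℝ) ^ checkpointExponent N j) := by rw [hiddenGap]; ring
    _ = 1 / 16 := by rw [h2, mul_one]

theorem hiddenGap_mul_rpow (N : ℕ) {M : ℕ} (hM : 1 ≤ M) (j : ℕ) :
    hiddenGap N M j * (M : ℝ) ^ checkpointExponent N (j + 1) =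
      1 / 4 * (M : ℝ) ^ (1 / (2 - ((2 : ℝ) ^ N)⁻¹)) := by
  have hM0 : (0 : ℝ) < M := by exact_mod_cast hM
  rw [hiddenGap, mul_assoc, ← Real.rpow_add hM0, ← checkpointExponent_succ_sub N j]
  ring_nf

/-- With `X = M ^ x_{j+1}`, the earlier checkpoint and the rounding each lose at most `X / 4`.
Keeping only `X / 4` of the rest, times the `1 / 4` in `hiddenGap`, gives `1 / 16`. -/
theorem eventually_hiddenGap_mul_checkpoint_sub_ge (N j : ℕ) :
    ∀ᶠ M : ℕ in atTop, 1 / 16 * (M : ℝ) ^ (1 / (2 - ((2 : ℝ) ^ N)⁻¹)) ≤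
      hiddenGap N M j * ((checkpoint N M (j + 1) : ℝ) - checkpoint N M j) := by
  have hx := checkpointExponent_strictMono N (Nat.lt_succ_self j)
  have hx0 : 0 < checkpointExponent N (j + 1) := (checkpointExponent_nonneg N j).trans_lt hx
  have e1 : ∀ᶠ M : ℕ in atTop, (M : ℝ) ^ checkpointExponent N j ≤
      1 / 4 * (M : ℝ) ^ checkpointExponent N (j + 1) := by
    have := ((tendsto_rpow_atTop (sub_pos.2 hx)).comp
      (tendsto_natCast_atTop_atTop (R := ℝ))).eventually_ge_atTop 4
    filter_upwards [this, eventually_ge_atTop 1] with M h hM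
    have hM0 : (0 : ℝ) < M := by exact_mod_cast hM
    have h1 := mul_le_mul_of_nonneg_left h (Real.rpow_pos_of_pos hM0 (checkpointExponent N j)).le
    rw [Function.comp_apply, ← Real.rpow_add hM0, add_sub_cancel] at h1
    linarith
  have e2 : ∀ᶠ M : ℕ in atTop, (4 : ℝ) ≤ (M : ℝ) ^ checkpointExponent N (j + 1) :=
    ((tendsto_rpow_atTop hx0).comp tendsto_natCast_atTop_atTop).eventually_ge_atTop 4
  filter_upwards [e1, e2, eventually_ge_atTop 1] with M h1 h2 hM
  have h3 : (checkpoint N M j : ℝ) ≤ (M : ℝ) ^ checkpointExponent N j :=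
    Nat.floor_le (by positivity)
  have h4 : (M : ℝ) ^ checkpointExponent N (j + 1) < (checkpoint N M (j + 1) : ℝ) + 1 :=
    Nat.lt_floor_add_one _
  have h5 := mul_le_mul_of_nonneg_left (show 1 / 4 * (M : ℝ) ^ checkpointExponent N (j + 1) ≤
    (checkpoint N M (j + 1) : ℝ) - checkpoint N M j by linarith) (hiddenGap_pos N hM j).le
  have h6 := hiddenGap_mul_rpow N hM j
  linarith

/-! ### Every action is chosen between consecutive checkpoints -/

/-- The mean rewards `hiddenGap N M N` for action `i₀`, and `0` for the others. -/
def baseMean (N M : ℕ) (i₀ i : Fin k) : ℝ := if i = i₀ then hiddenGap N M N else 0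

theorem baseMean_nonneg (N : ℕ) {M : ℕ} (hM : 1 ≤ M) (i₀ i : Fin k) : 0 ≤ baseMean N M i₀ i := by
  unfold baseMean
  split_ifs
  exacts [(hiddenGap_pos N hM N).le, le_rfl]

theorem baseMean_le (N : ℕ) {M : ℕ} (hM : 1 ≤ M) (i₀ i : Fin k) :
    baseMean N M i₀ i ≤ hiddenGap N M N := by
  unfold baseMean
  split_ifs
  exacts [le_rfl, (hiddenGap_pos N hM N).le]

theorem baseMean_mem (N : ℕ) {M : ℕ} (hM : 1 ≤ M) (i₀ i : Fin k) :
    baseMean N M i₀ i ∈ Set.Icc (0 : ℝ) (1 / 2) :=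
  ⟨baseMean_nonneg N hM i₀ i, by linarith [baseMean_le N hM i₀ i, hiddenGap_le N hM N]⟩

/-- The constant is `2 * 16`: a factor `2` for the change of environment and `16` from the lower
bound on the cost of skipping. -/
theorem sq_law_avoiding_checkpoint_le (π : Policy k) {N M : ℕ} (hM : 1 ≤ M) (i₀ i : Fin k) {j : ℕ}
    (hj : j ≤ N) (hw : 1 / 16 * (M : ℝ) ^ (1 / (2 - ((2 : ℝ) ^ N)⁻¹)) ≤
      hiddenGap N M j * ((checkpoint N M (j + 1) : ℝ) - checkpoint N M j)) :
    (law π (twoPointEnv _ (baseMean_mem N hM i₀)) (2 * M)).real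
        (avoiding i (checkpoint N M j) (checkpoint N M (j + 1)) (2 * M)) ^ 2 ≤
      32 * (regret π (2 * M) / (M : ℝ) ^ (1 / (2 - ((2 : ℝ) ^ N)⁻¹))) := by
  set D := twoPointEnv _ (baseMean_mem N hM i₀) with hD
  set δ := hiddenGap N M j with hδ
  have hδ0 : 0 < δ := hiddenGap_pos N hM j
  have hδN : hiddenGap N M N ≤ δ := hiddenGap_antitone N hM hj
  -- The alternative environment puts `i` above every base mean by at least `δ`; both gaps are at
  -- most `1 / 4`, so means stay below `1 / 2`.
  have hm' : ∀ l, Function.update (baseMean N M i₀) i (hiddenGap N M N + δ) l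
      ∈ Set.Icc (0 : ℝ) (1 / 2) := by
    intro l
    by_cases hl : l = i
    · subst hl
      rw [Function.update_self]
      constructor <;>
        linarith [hiddenGap_pos N hM N, hiddenGap_le N hM N, hiddenGap_le N hM j]
    · rw [Function.update_of_ne hl]
      exact baseMean_mem N hM i₀ l
  set D' := twoPointEnv _ hm' with hD'
  set B := avoiding i (checkpoint N M j) (checkpoint N M (j + 1)) (2 * M) with hB
  have hT : checkpoint N M (j + 1) ≤ 2 * M := by
    have := checkpoint_mono N hM (Nat.succ_le_succ hj)
    rw [Nat.succ_eq_add_one, Nat.succ_eq_add_one, checkpoint_last] at this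
    omega
  have hreg : δ * ((checkpoint N M (j + 1) : ℝ) - checkpoint N M j) * (law π D' (2 * M)).real B ≤
      regret π (2 * M) := by
    refine mul_law_avoiding_le_regret π D' (checkpoint_mono N hM (Nat.le_succ j)) hT
      fun l hl => ?_
    rw [hD', mean_twoPointEnv, mean_twoPointEnv, Function.update_self, Function.update_of_ne hl]
    linarith [baseMean_le N hM i₀ l]
  set c : ℝ := 1 + 2 * (baseMean N M i₀ i - (hiddenGap N M N + δ)) ^ 2 with hc
  have hc1 : 1 ≤ c := by
    have := sq_nonneg (baseMean N M i₀ i - (hiddenGap N M N + δ))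
    linarith
  have hcp : c ^ checkpoint N M j ≤ 2 := by
    -- The mean of `i` moves by at most `δ_N + δ_j ≤ 2 * δ_j`, so the total cost is at most `exp (8
    -- / 16) ≤ 2`.
    have h1 : (baseMean N M i₀ i - (hiddenGap N M N + δ)) ^ 2 ≤ (2 * δ) ^ 2 := by
      apply sq_le_sq'
      · linarith [baseMean_nonneg N hM i₀ i]
      · linarith [baseMean_le N hM i₀ i]
    calc c ^ checkpoint N M j ≤ Real.exp (8 * δ ^ 2) ^ checkpoint N M j := by
          refine pow_le_pow_left₀ (by linarith) ?_ _
          linarith [Real.add_one_le_exp (8 * δ ^ 2)]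
      _ = Real.exp (8 * (δ ^ 2 * checkpoint N M j)) := by
          rw [← Real.exp_nat_mul]
          ring_nf
      _ ≤ Real.exp (Real.log 2) := by
          refine Real.exp_le_exp.2 ?_
          linarith [hiddenGap_sq_mul_checkpoint_le N hM j, Real.log_two_gt_d9]
      _ = 2 := Real.exp_log (by norm_num)
  have hcm := sq_law_avoiding_le π (D := D) (D' := D') (T := 2 * M) (i := i)
    (a := checkpoint N M j) (c := ENNReal.ofReal c) (by simpa using hc1)
    (fun l hl => by simp [hD, hD', twoPointEnv, Function.update_of_ne hl])
    (by
      have := sqDominated_twoPoint (baseMean_mem N hM i₀ i) (hm' i)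
      rw [Function.update_self] at this
      simpa [hD, hD', twoPointEnv] using this) hT
  have hcm' : (law π D (2 * M)).real B ^ 2 ≤ 2 * (law π D' (2 * M)).real B := by
    have h1 := ENNReal.toReal_mono (by finiteness) hcm
    rw [ENNReal.toReal_pow, ENNReal.toReal_mul, ENNReal.toReal_pow,
      ENNReal.toReal_ofReal (by linarith)] at h1
    exact h1.trans (mul_le_mul_of_nonneg_right hcp measureReal_nonneg)
  have hM0 : (0 : ℝ) < (M : ℝ) ^ (1 / (2 - ((2 : ℝ) ^ N)⁻¹)) :=
    Real.rpow_pos_of_pos (by exact_mod_cast hM) _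
  have h2 := (mul_le_mul_of_nonneg_right hw
    (measureReal_nonneg (μ := law π D' (2 * M)) (s := B))).trans hreg
  rw [← mul_div_assoc, le_div_iff₀ hM0]
  nlinarith

theorem law_avoiding_final_le (π : Policy k) {N M : ℕ} (hM : 1 ≤ M) (i₀ : Fin k) :
    (law π (twoPointEnv _ (baseMean_mem N hM i₀)) (2 * M)).real (avoiding i₀ M (2 * M) (2 * M)) ≤
      4 * (regret π (2 * M) / (M : ℝ) ^ (1 / (2 - ((2 : ℝ) ^ N)⁻¹))) := by
  have hreg := mul_law_avoiding_le_regret π (twoPointEnv _ (baseMean_mem N hM i₀)) (T := 2 * M)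
    (i := i₀) (a := M) (b := 2 * M) (by omega) le_rfl (δ := hiddenGap N M N) fun l hl => by
      rw [mean_twoPointEnv, mean_twoPointEnv]
      simp [baseMean, hl]
  have hM0 : (0 : ℝ) < (M : ℝ) ^ (1 / (2 - ((2 : ℝ) ^ N)⁻¹)) :=
    Real.rpow_pos_of_pos (by exact_mod_cast hM) _
  have h1 := hiddenGap_mul_rpow N hM N
  rw [checkpointExponent_last, Real.rpow_one] at h1
  have h2 : ((2 * M : ℕ) : ℝ) - M = M := by push_cast; ring
  rw [h2, h1] at hreg
  rw [← mul_div_assoc, le_div_iff₀ hM0]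
  linarith

theorem isOptimal_baseEnv (N : ℕ) {M : ℕ} (hM : 1 ≤ M) (i₀ : Fin k) :
    (twoPointEnv _ (baseMean_mem N hM i₀)).IsOptimal i₀ := by
  intro l hl
  rw [mean_twoPointEnv, mean_twoPointEnv]
  simpa [baseMean, hl] using hiddenGap_pos N hM N

theorem coversThenSwitchesTo_of_notMem_avoiding {N M : ℕ} (hM : 1 ≤ M) (i₀ : Fin k)
    {h : History k (2 * M)}
    (hc : ∀ (j : Fin (N + 1)) (i : Fin k),
      h ∉ avoiding i (checkpoint N M j) (checkpoint N M (j + 1)) (2 * M))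
    (hf : h ∉ avoiding i₀ M (2 * M) (2 * M)) :
    CoversThenSwitchesTo (actions h) (N + 1) i₀ := by
  -- `avoiding` numbers rounds from `0`, so the `j`-th cover occupies the rounds `t_j + 1, …,
  -- t_{j+1}`, and `τ = t_{N+1} = M`.
  refine ⟨M, ⟨fun j => checkpoint N M j + 1, fun j => checkpoint N M (j + 1), fun j => ⟨?_, ?_, ?_⟩,
    ?_⟩, ?_⟩
  · exact Nat.le_add_left _ _
  · have := checkpoint_mono N hM (show (j : ℕ) + 1 ≤ N + 1 by omega)
    rwa [checkpoint_last] at this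
  · intro i
    have := hc j i
    simp only [avoiding, Set.mem_ofPred_eq, not_forall, not_not] at this
    obtain ⟨t, h1, h2, h3⟩ := this
    exact ⟨t, Nat.succ_le_succ h1, h2, h3⟩
  · intro j j' hjj
    simp only
    rw [hjj]
    omega
  · simp only [avoiding, Set.mem_ofPred_eq, not_forall, not_not] at hf
    obtain ⟨t, h1, h2, h3⟩ := hf
    exact ⟨t, by omega, h3⟩

/-! ### The regret bound -/

/-- The saving `ε` in the exponent absorbs the power of the logarithm; doubling the horizon costs
only the factor `2 ^ α`. -/
theorem AchievesRegretExponent.tendsto_div {π : Policy k} {α ε : ℝ} (hε : 0 < ε)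
    (hπ : AchievesRegretExponent π (α - ε)) :
    Tendsto (fun M : ℕ => regret π (2 * M) / (M : ℝ) ^ α) atTop (𝓝 0) := by
  obtain ⟨p, hp⟩ := hπ
  have h1 : (fun x : ℝ => x ^ (α - ε) * Real.log x ^ p) =o[atTop] fun x : ℝ => x ^ α := by
    have h2 : (fun x : ℝ => Real.log x ^ p) =o[atTop] fun x : ℝ => x ^ ε := by
      simpa using isLittleO_log_rpow_rpow_atTop (p : ℝ) hε
    refine ((Asymptotics.isBigO_refl (fun x : ℝ => x ^ (α - ε)) atTop).mul_isLittleO h2).congr'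
      EventuallyEq.rfl ?_
    filter_upwards [eventually_gt_atTop 0] with x hx
    rw [← Real.rpow_add hx, sub_add_cancel]
  have h3 := hp.trans_isLittleO (h1.comp_tendsto tendsto_natCast_atTop_atTop)
  have h4 : Tendsto (fun M : ℕ => 2 * M) atTop atTop :=
    tendsto_id.const_mul_atTop' (by norm_num)
  have h5 := (h3.comp_tendsto h4).tendsto_div_nhds_zero.const_mul ((2 : ℝ) ^ α)
  rw [mul_zero] at h5
  refine h5.congr' ?_
  filter_upwards [eventually_ge_atTop 1] with M hM
  have hM0 : (0 : ℝ) < M := by exact_mod_cast hM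
  simp only [Function.comp_apply, Nat.cast_mul, Nat.cast_ofNat]
  rw [Real.mul_rpow (by norm_num) hM0.le]
  have := Real.rpow_pos_of_pos hM0 α
  have := Real.rpow_pos_of_pos (show (0 : ℝ) < 2 by norm_num) α
  field_simp

end Bandit

end
-- Union bound over skipped periods
theorem theorem10 (k : ℕ) (hk : 1 ≤ k) (N : ℕ) (π : Bandit.Policy k) (ε : ℝ) (hε : 0 < ε)
    (hπ : Bandit.AchievesRegretExponent π (1 / (2 - ((2 : ℝ) ^ N)⁻¹) - ε)) :
    ∃ (D : Bandit.Environment k) (T : ℕ) (i : Fin k), 1 ≤ T ∧ D.IsOptimal i ∧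
      max ((N : ℝ) / ((N : ℝ) + 1)) (1 / 2) ≤
        (Bandit.law π D T).real
          {h | Bandit.CoversThenSwitchesTo (Bandit.actions h) (N + 1) i} := by
  open Bandit in
  have hr := hπ.tendsto_div hε
  set r : ℕ → ℝ := fun M => regret π (2 * M) / (M : ℝ) ^ (1 / (2 - ((2 : ℝ) ^ N)⁻¹)) with hrdef
  -- The union bound on failure: `(N + 1) * k` pairs of a period and an action, plus missing `i₀` in
  -- the last `M` rounds. It vanishes, so any target below `1` is reached.
  have hlim : Tendsto (fun M => ((N + 1 : ℕ) : ℝ) * (k * √(32 * r M)) + 4 * r M) atTop (nhds 0) := by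
    have h1 : Tendsto (fun M => √(32 * r M)) atTop (nhds 0) := by
      simpa using (hr.const_mul 32).sqrt
    simpa using ((h1.const_mul (k : ℝ)).const_mul ((N + 1 : ℕ) : ℝ)).add (hr.const_mul 4)
  have hlt : max ((N : ℝ) / ((N : ℝ) + 1)) (1 / 2) < 1 := by
    refine max_lt ?_ (by norm_num)
    rw [div_lt_one (by positivity)]
    linarith
  have hwin : ∀ᶠ M : ℕ in atTop, ∀ j : Fin (N + 1),
      1 / 16 * (M : ℝ) ^ (1 / (2 - ((2 : ℝ) ^ N)⁻¹)) ≤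
        hiddenGap N M j * ((checkpoint N M (j + 1) : ℝ) - checkpoint N M j) :=
    eventually_all.2 fun j => eventually_hiddenGap_mul_checkpoint_sub_ge N j
  obtain ⟨M, hM, hw, hsmall⟩ := ((eventually_ge_atTop 1).and
    (hwin.and (hlim.eventually_lt_const (sub_pos.2 hlt)))).exists
  set i₀ : Fin k := ⟨0, hk⟩
  refine ⟨twoPointEnv _ (baseMean_mem N hM i₀), 2 * M, i₀, by omega, isOptimal_baseEnv N hM i₀, ?_⟩
  set P := law π (twoPointEnv _ (baseMean_mem N hM i₀)) (2 * M)
  set G := {h : History k (2 * M) | CoversThenSwitchesTo (actions h) (N + 1) i₀}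
  set C := fun (j : Fin (N + 1)) (i : Fin k) =>
    avoiding i (checkpoint N M j) (checkpoint N M (j + 1)) (2 * M)
  have hcover : Set.univ ⊆ G ∪ ((⋃ j, ⋃ i, C j i) ∪ avoiding i₀ M (2 * M) (2 * M)) := by
    intro h _
    by_contra hn
    simp only [Set.mem_union, Set.mem_iUnion, not_or, not_exists] at hn
    exact hn.1 (coversThenSwitchesTo_of_notMem_avoiding hM i₀ hn.2.1 hn.2.2)
  have hC : ∀ j i, P.real (C j i) ≤ √(32 * r M) := fun j i =>
    Real.le_sqrt_of_sq_le (sq_law_avoiding_checkpoint_le π hM i₀ i (by omega) (hw j))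
  have hU : P.real (⋃ j, ⋃ i, C j i) ≤ ((N + 1 : ℕ) : ℝ) * (k * √(32 * r M)) := by
    refine (measureReal_iUnion_fintype_le _).trans ?_
    refine (Finset.sum_le_card_nsmul _ _ (k * √(32 * r M)) fun j _ => ?_).trans (by simp)
    refine (measureReal_iUnion_fintype_le _).trans ?_
    exact (Finset.sum_le_card_nsmul _ _ _ fun i _ => hC j i).trans (by simp)
  have h1 : (1 : ℝ) ≤ P.real G + (P.real (⋃ j, ⋃ i, C j i) +
      P.real (avoiding i₀ M (2 * M) (2 * M))) := by
    calc (1 : ℝ) = P.real Set.univ := by simp [P]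
      _ ≤ P.real (G ∪ ((⋃ j, ⋃ i, C j i) ∪ avoiding i₀ M (2 * M) (2 * M))) :=
          measureReal_mono hcover
      _ ≤ _ := (measureReal_union_le _ _).trans (by gcongr; exact measureReal_union_le _ _)
  linarith [law_avoiding_final_le π (N := N) hM i₀]
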